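/- Let $p$ be a prime, $n\ge 0$, and let $e=(e_1,\dots,e_n)$ be integers with $1\le e_1\le e_2\le\dots\le e_n$. Let $P$ be a finite abelian $p$-group of type $e$, that is, $P\cong\bigoplus_{i=1}^n \mathbb{Z}/p^{e_i}\mathbb{Z}$. For $i\in\{1,\dots,p-1\}$ let $\mu_i$ be the automorphism $x\mapsto ix$ of $P$, and for $\varphi\in\operatorname{Aut}(P)$ put $\Pi(\varphi)=\prod_{i=1}^{p-1}|\operatorname{Fix}(\mu_i\circ\varphi)|$, where $\operatorname{Fix}(\psi)=\{x\in P:\psi(x)=x\}$. Decompose the sequence $e$ into blocks as follows. (1) Each maximal constant subsequence $e_i=e_{i+1}=\dots=e_j$ of length at least $2$ forms an $a$-block. (2) Among the remaining entries, starting from the left, successive entries $e_i,e_{i+1}$ with $e_{i+1}=e_i+1$ are paired, each entry being used at most once; each such pair forms a $b$-block. (3) Each entry that then still remains forms a $c$-block by itself. Let $b(e)$ and $c(e)$ be the numbers of $b$-blocks and $c$-blocks, and let $\Sigma(e)=\sum_{i=1}^n e_i$. Then $$\{\Pi(\varphi) : \varphi\in\operatorname{Aut}(P)\}=\{p^m :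 m\in\mathbb{Z},\ b(e)+c(e)\le m\le \Sigma(e)\}.$$ -/

import Mathlib

namespace AbelianPGroup

/-- `E n`: the non-decreasing `n`-tuples of positive integers. -/
def E (n : ℕ) : Set (Fin n → ℕ) := {e | (∀ i, 1 ≤ e i) ∧ Monotone e}

/-- The abelian `p`-group `⨁ᵢ ℤ / p ^ eᵢ ℤ` attached to the tuple `e`. -/
abbrev StdGroup (p : ℕ) {n : ℕ} (e : Fin n → ℕ) : Type := ∀ i : Fin n, ZMod (p ^ e i)

/-- `P` is a finite abelian `p`-group of type `e`. -/
def IsOfType (p : ℕ) {n : ℕ} (e : Fin n → ℕ) (P : Type*) [AddCommGroup P] : Prop :=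
  e ∈ E n ∧ Nonempty (P ≃+ StdGroup p e)

section FixedPoints

variable (p : ℕ) (P : Type*) [AddCommGroup P]

variable {P} in
/-- `Π(φ) = ∏_{i = 1}^{p - 1} |Fix (μᵢ ∘ φ)|`, where `μᵢ x = i x`. -/
noncomputable def prodFix (φ : P ≃+ P) : ℕ :=
  ∏ i ∈ Finset.Icc 1 (p - 1),
    Nat.card (Function.fixedPoints (⇑(nsmulAddMonoidHom i : P →+ P) ∘ ⇑φ))

/-- The set of values of `Π` over all automorphisms of `P`. -/
def prodSpec : Set ℕ := Set.range fun φ : P ≃+ P => prodFix p φ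

end FixedPoints

section Decomposition

variable {n : ℕ} (e : Fin n → ℕ)

/-- The index `i` lies in an `a`-block. For non-decreasing `e` the indices of one value are
consecutive, so the maximal constant subsequences of length at least two are exactly the sets
of indices of the values that occur at least twice. -/
def InA (i : Fin n) : Prop := ∃ j, j ≠ i ∧ e j = e i

/-- The entries at positions `k` and `k + 1` (counted from `0`) both exist, lie in no `a`-block,
and the second is one more than the first. -/
def IsBCandidate (k : ℕ) : Prop :=
  ∃ h : k + 1 < n, ¬ InA e ⟨k, k.lt_of_succ_lt h⟩ ∧ ¬ InA e ⟨k + 1, h⟩ ∧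
    e ⟨k + 1, h⟩ = e ⟨k, k.lt_of_succ_lt h⟩ + 1

/-- Position `k` is the first position of a `b`-block. Pairs are formed from the left: a candidate
pair is taken unless its first entry has just been used as the second entry of a pair. -/
def IsBStart : ℕ → Prop
  | 0 => IsBCandidate e 0
  | k + 1 => IsBCandidate e (k + 1) ∧ ¬ IsBStart k

/-- The index `i` lies in a `b`-block, as its first or as its second entry. -/
def InB (i : Fin n) : Prop := IsBStart e i ∨ ∃ k, k + 1 = (i : ℕ) ∧ IsBStart e k

/-- The number `b(e)` of `b`-blocks, counted by their first entries. -/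
noncomputable def bCount : ℕ := Nat.card {i : Fin n // IsBStart e i}

/-- The number `c(e)` of `c`-blocks: the entries in no `a`-block and no `b`-block. -/
noncomputable def cCount : ℕ := Nat.card {i : Fin n // ¬ InA e i ∧ ¬ InB e i}

end Decomposition

end AbelianPGroup

/-! `Π(φ)` is the product of the orders of the kernels of `kφ - 1`, `1 ≤ k ≤ p - 1`, each a power of
`p`.

Upper bound (`prod_card_ker_le`): differences of distinct `k` are units mod `p`, so these kernels
are independent and the product of their orders is at most `|P|`.

Lower bound (`pow_card_le_prodFix`): let `T` consist of the first entries of the `b`-blocks and the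
`c`-entries. The values of `e` on `T` are attained only once and differ pairwise by at least 2. A
value attained once forces the diagonal entry of `φ` there to be a unit mod `p`, so some `kφ - 1`
has a diagonal entry divisible by `p`. If this happens for a given `k` on a set `S ⊆ T`, then `kφ -
1` maps some subgroup into another one smaller by the factor `p ^ #S`, whence a kernel of at least
that order (`pow_card_le_card_ker`).

Realization (`realizes_univ`): `Π` is multiplicative on direct sums and intervals of exponents add,
so blocks can be treated separately. Automorphisms `1 + ν` with `ν²` divisible by `p` give `|ker ν|`
(`card_ker_mem_prodSpec`); companion matrices of polynomials without roots mod `p` give `1` on equal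
summands. -/

namespace AbelianPGroup

open Finset

/-! ### Fixed points as kernels; isomorphism invariance and multiplicativity of `Π`. -/

section Transfer

variable (p : ℕ) {P Q : Type*} [AddCommGroup P] [AddCommGroup Q]

/-- The homomorphism `x ↦ k φ(x) - x`. -/
def smulSubOne (k : ℕ) (φ : P →+ P) : P →+ P := k • φ - AddMonoidHom.id P

@[simp] lemma smulSubOne_apply (k : ℕ) (φ : P →+ P) (x : P) :
    smulSubOne k φ x = k • φ x - x := rfl

lemma card_fixedPoints (k : ℕ) (φ : P ≃+ P) :
    Nat.card (Function.fixedPoints (⇑(nsmulAddMonoidHom k : P →+ P) ∘ ⇑φ)) =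
      Nat.card (smulSubOne k φ.toAddMonoidHom).ker := by
  refine Nat.card_congr (Equiv.subtypeEquivRight fun x => ?_)
  rw [AddMonoidHom.mem_ker, smulSubOne_apply, sub_eq_zero]
  rfl

lemma prodFix_eq (φ : P ≃+ P) :
    prodFix p φ = ∏ k ∈ Icc 1 (p - 1), Nat.card (smulSubOne k φ.toAddMonoidHom).ker :=
  prod_congr rfl fun k _ => card_fixedPoints k φ

lemma prodFix_conj (g : P ≃+ Q) (φ : P ≃+ P) :
    prodFix p ((g.symm.trans φ).trans g) = prodFix p φ := by
  refine prod_congr rfl fun k _ => (Nat.card_congr (g.toEquiv.subtypeEquiv fun x => ?_)).symm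
  change k • φ x = x ↔ k • g (φ (g.symm (g x))) = g x
  rw [g.symm_apply_apply, ← map_nsmul g, g.injective.eq_iff]

lemma prodSpec_congr (g : P ≃+ Q) : prodSpec p P = prodSpec p Q := by
  ext N
  constructor
  · rintro ⟨φ, rfl⟩
    exact ⟨_, prodFix_conj p g φ⟩
  · rintro ⟨φ, rfl⟩
    exact ⟨_, prodFix_conj p g.symm φ⟩

lemma prodFix_prodCongr (φ : P ≃+ P) (θ : Q ≃+ Q) :
    prodFix p (φ.prodCongr θ) = prodFix p φ * prodFix p θ := by
  unfold prodFix
  rw [← prod_mul_distrib]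
  refine prod_congr rfl fun k _ => ?_
  rw [← Nat.card_prod]
  refine Nat.card_congr ((Equiv.subtypeEquivRight fun x => ?_).trans
    (Equiv.subtypeProdEquivProd
      (p := fun x => x ∈ Function.fixedPoints (⇑(nsmulAddMonoidHom k : P →+ P) ∘ ⇑φ))
      (q := fun x => x ∈ Function.fixedPoints (⇑(nsmulAddMonoidHom k : Q →+ Q) ∘ ⇑θ))))
  simp only [Function.mem_fixedPoints, Function.IsFixedPt, Prod.ext_iff]
  rfl

lemma mul_mem_prodSpec_prod {a b : ℕ} (ha : a ∈ prodSpec p P) (hb : b ∈ prodSpec p Q) :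
    a * b ∈ prodSpec p (P × Q) := by
  obtain ⟨φ, rfl⟩ := ha
  obtain ⟨θ, rfl⟩ := hb
  exact ⟨_, prodFix_prodCongr p φ θ⟩

end Transfer

/-! ### Upper bound: independence of the kernels. -/

section UpperBound

variable {p : ℕ} {P : Type*} [AddCommGroup P]

lemma eq_zero_of_zsmul_eq_zero {N : ℕ} (hp : p.Prime) (hP : ∀ x : P, p ^ N • x = 0) {k : ℤ}
    (hk : ¬ (p : ℤ) ∣ k) {x : P} (hx : k • x = 0) : x = 0 := by
  have hc : IsCoprime k ((p : ℤ) ^ N) :=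
    (((Nat.prime_iff_prime_int.mp hp).coprime_iff_not_dvd.mpr hk).symm).pow_right
  obtain ⟨a, b, hab⟩ := hc
  have h1 : ((p : ℤ) ^ N) • x = 0 := by
    have := hP x
    rw [← natCast_zsmul] at this
    simpa using this
  rw [← one_zsmul x, ← hab, add_smul, mul_smul, mul_smul, hx, h1, smul_zero, smul_zero, add_zero]

lemma commute_smulSubOne (φ : P →+ P) (j k : ℕ) (x : P) :
    smulSubOne j φ (smulSubOne k φ x) = smulSubOne k φ (smulSubOne j φ x) := by
  simp only [smulSubOne_apply, map_sub, map_nsmul, smul_sub]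
  rw [smul_comm]
  abel

lemma prod_card_ker_le [Finite P] {N : ℕ} (hp : p.Prime) (hP : ∀ x : P, p ^ N • x = 0)
    (φ : P →+ P) (s : Finset ℕ) (hs : s ⊆ Icc 1 (p - 1)) :
    ∏ k ∈ s, Nat.card (smulSubOne k φ).ker ≤ Nat.card P := by
  -- `Ψ` is the composite of the commuting maps `kφ - 1`, `k ∈ s`. It preserves every kernel and is
  -- injective on those of the unused `k`.
  suffices H : ∃ Ψ : P →+ P, (∀ k x, smulSubOne k φ x = 0 → smulSubOne k φ (Ψ x) = 0) ∧
      (∀ k ∈ Icc 1 (p - 1), k ∉ s → ∀ x, smulSubOne k φ x = 0 → Ψ x = 0 → x = 0) ∧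
      ∏ k ∈ s, Nat.card (smulSubOne k φ).ker ≤ Nat.card Ψ.ker by
    obtain ⟨Ψ, -, -, h⟩ := H
    exact h.trans (Nat.card_le_card_of_injective _ Subtype.val_injective)
  induction s using Finset.induction_on with
  | empty => exact ⟨AddMonoidHom.id P, fun k x h => h, fun k _ _ x _ h => h, by simp⟩
  | insert i s hi ih =>
    obtain ⟨Ψ, h1, h2, h3⟩ := ih fun k hk => hs (mem_insert_of_mem hk)
    have hiI := hs (mem_insert_self i s)
    refine ⟨(smulSubOne i φ).comp Ψ, fun k x hx => ?_, fun k hk hks x hx hΨ => ?_, ?_⟩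
    · rw [AddMonoidHom.comp_apply, commute_smulSubOne, h1 k x hx, map_zero]
    · rw [mem_insert, not_or] at hks
      refine h2 k hk hks.2 x hx ?_
      rw [AddMonoidHom.comp_apply] at hΨ
      have hk' := h1 k x hx
      set y := Ψ x
      rw [smulSubOne_apply, sub_eq_zero] at hΨ hk'
      -- Both `iφ` and `kφ` fix `y`, so `i y = i k φ(y) = k y`.
      have hy : ((i : ℤ) - k) • y = 0 := by
        rw [sub_smul, natCast_zsmul, natCast_zsmul, sub_eq_zero]
        nth_rewrite 1 [← hk']
        nth_rewrite 2 [← hΨ]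
        rw [smul_comm]
      refine eq_zero_of_zsmul_eq_zero hp hP (fun hd => hks.1 ?_) hy
      rw [mem_Icc] at hk hiI
      have := Int.eq_zero_of_abs_lt_dvd hd (by have := hp.pos; rw [abs_lt]; omega)
      omega
    · rw [prod_insert hi]
      refine (Nat.mul_le_mul_left _ h3).trans ?_
      rw [← Nat.card_prod]
      -- The sum of the two kernels is direct and lies in the kernel of the composite.
      have hmem : ∀ z : (smulSubOne i φ).ker × Ψ.ker,
          (z.1 + z.2 : P) ∈ ((smulSubOne i φ).comp Ψ).ker := by
        rintro ⟨⟨x, hx⟩, ⟨y, hy⟩⟩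
        rw [AddMonoidHom.mem_ker] at *
        simp only [AddMonoidHom.comp_apply, map_add, hy, map_zero, add_zero]
        exact h1 i x hx
      refine Nat.card_le_card_of_injective (fun z => ⟨z.1 + z.2, hmem z⟩) ?_
      rintro ⟨⟨x, hx⟩, ⟨y, hy⟩⟩ ⟨⟨x', hx'⟩, ⟨y', hy'⟩⟩ h
      rw [AddMonoidHom.mem_ker] at *
      have h : x + y = x' + y' := congrArg Subtype.val h
      have hxy : x - x' = y' - y := by rw [sub_eq_sub_iff_add_eq_add, h, add_comm]
      have hz : x - x' = 0 := h2 i hiI hi _ (by rw [map_sub, hx, hx', sub_zero])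
        (by rw [hxy, map_sub, hy, hy', sub_zero])
      have hx0 := sub_eq_zero.mp hz
      have hy0 : y = y' := by rw [hz] at hxy; exact (sub_eq_zero.mp hxy.symm).symm
      simp [hx0, hy0]

lemma exists_prodFix_eq_pow [Finite P] {N : ℕ} (hp : p.Prime) (hP : Nat.card P = p ^ N)
    (φ : P ≃+ P) : ∃ m ≤ N, prodFix p φ = p ^ m := by
  have hP' : ∀ x : P, p ^ N • x = 0 := fun x => by rw [← hP]; exact card_nsmul_eq_zero'
  have hle : prodFix p φ ≤ p ^ N := by
    rw [prodFix_eq, ← hP]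
    exact prod_card_ker_le hp hP' _ _ Subset.rfl
  have hpow : ∀ k : ℕ, ∃ m, Nat.card (smulSubOne k φ.toAddMonoidHom).ker = p ^ m := fun k => by
    obtain ⟨m, -, h⟩ := (Nat.dvd_prime_pow hp).mp
      (hP ▸ AddSubgroup.card_addSubgroup_dvd_card (smulSubOne k φ.toAddMonoidHom).ker)
    exact ⟨m, h⟩
  choose m hm using hpow
  have h : prodFix p φ = p ^ ∑ k ∈ Icc 1 (p - 1), m k := by
    rw [prodFix_eq, ← prod_pow_eq_pow_sum]
    exact prod_congr rfl fun k _ => hm k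
  refine ⟨_, ?_, h⟩
  rw [h] at hle
  exact (Nat.pow_le_pow_iff_right hp.one_lt).mp hle

end UpperBound

/-! ### Lower bound: matrix entries and filtrations by divisibility. -/

section LowerBound

variable {p n : ℕ} {e : Fin n → ℕ}

/-- The vectors whose `i`-th entry is divisible by `p ^ f i`. -/
def divSubgroup (p : ℕ) (e f : Fin n → ℕ) : AddSubgroup (StdGroup p e) where
  carrier := {x | ∀ i, (p : ZMod (p ^ e i)) ^ f i ∣ x i}
  zero_mem' _ := dvd_zero _
  add_mem' hx hy i := dvd_add (hx i) (hy i)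
  neg_mem' hx i := (dvd_neg).mpr (hx i)

lemma card_pow_dvd (hp : p.Prime) {a b : ℕ} (h : b ≤ a) :
    Nat.card {y : ZMod (p ^ a) // (p : ZMod (p ^ a)) ^ b ∣ y} = p ^ (a - b) := by
  have hset : ∀ y : ZMod (p ^ a), (p : ZMod (p ^ a)) ^ b ∣ y ↔
      y ∈ AddSubgroup.zmultiples ((p ^ b : ℕ) : ZMod (p ^ a)) := by
    have : NeZero (p ^ a) := ⟨(pow_pos hp.pos a).ne'⟩
    intro y
    rw [AddSubgroup.mem_zmultiples_iff]
    constructor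
    · rintro ⟨z, rfl⟩
      exact ⟨z.val, by simp [mul_comm]⟩
    · rintro ⟨k, rfl⟩
      exact ⟨k, by simp [mul_comm]⟩
  rw [Nat.card_congr (Equiv.subtypeEquivRight hset)]
  change Nat.card (AddSubgroup.zmultiples ((p ^ b : ℕ) : ZMod (p ^ a))) = _
  rw [Nat.card_zmultiples, ZMod.addOrderOf_coe _ (pow_pos hp.pos a).ne',
    Nat.gcd_eq_right (pow_dvd_pow p h), Nat.pow_div h hp.pos]

lemma card_divSubgroup (hp : p.Prime) {f : Fin n → ℕ} (h : ∀ i, f i ≤ e i) :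
    Nat.card (divSubgroup p e f) = p ^ ∑ i, (e i - f i) := by
  have h1 : Nat.card (divSubgroup p e f) =
      Nat.card (∀ i, {y : ZMod (p ^ e i) // (p : ZMod (p ^ e i)) ^ f i ∣ y}) :=
    Nat.card_congr (Equiv.subtypePiEquivPi
      (p := fun {i} (y : ZMod (p ^ e i)) => (p : ZMod (p ^ e i)) ^ f i ∣ y))
  rw [h1, Nat.card_pi, ← prod_pow_eq_pow_sum]
  exact prod_congr rfl fun i _ => card_pow_dvd hp (h i)

lemma card_stdGroup (p : ℕ) (e : Fin n → ℕ) : Nat.card (StdGroup p e) = p ^ ∑ i, e i := by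
  rw [Nat.card_pi, ← prod_pow_eq_pow_sum]
  exact prod_congr rfl fun i _ => Nat.card_zmod _

lemma card_le_card_ker_mul {G : Type*} [AddCommGroup G] [Finite G] (ψ : G →+ G)
    {H K : AddSubgroup G} (h : ∀ x ∈ H, ψ x ∈ K) :
    Nat.card H ≤ Nat.card ψ.ker * Nat.card K := by
  let θ : H →+ K := (ψ.comp H.subtype).codRestrict K fun x => h x x.2
  rw [← θ.ker.card_mul_index, AddSubgroup.index_ker]
  refine Nat.mul_le_mul ?_ (Nat.card_le_card_of_injective _ Subtype.val_injective)
  refine Nat.card_le_card_of_injective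
    (fun x : θ.ker => (⟨x.1.1, congrArg Subtype.val x.2⟩ : ψ.ker)) ?_
  intro x y hxy
  have h1 : x.1.1 = y.1.1 := congrArg (fun z : ψ.ker => (z : G)) hxy
  exact Subtype.ext (Subtype.ext h1)

lemma map_single_eq (hp : p.Prime) (ψ : StdGroup p e →+ StdGroup p e) (j : Fin n)
    (x : ZMod (p ^ e j)) :
    ψ (Pi.single j x) = x.val • ψ (Pi.single j 1) := by
  have : NeZero (p ^ e j) := ⟨(pow_pos hp.pos _).ne'⟩
  rw [← map_nsmul, ← Pi.single_smul]
  simp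

lemma map_apply_eq_sum (ψ : StdGroup p e →+ StdGroup p e) (x : StdGroup p e) (i : Fin n) :
    ψ x i = ∑ j, ψ (Pi.single j (x j)) i := by
  conv_lhs => rw [← Finset.univ_sum_single x]
  rw [map_sum, Finset.sum_apply]

lemma pow_dvd_of_pow_smul_eq_zero (hp : p.Prime) {a b : ℕ} {y : ZMod (p ^ a)}
    (h : p ^ b • y = 0) : (p : ZMod (p ^ a)) ^ (a - b) ∣ y := by
  have : NeZero (p ^ a) := ⟨(pow_pos hp.pos _).ne'⟩
  have h1 : p ^ a ∣ p ^ b * y.val := by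
    rw [← ZMod.natCast_eq_zero_iff]
    simpa using h
  have h2 : p ^ (a - b) ∣ y.val := by
    rcases le_total a b with hab | hab
    · simp [Nat.sub_eq_zero_of_le hab]
    · refine Nat.dvd_of_mul_dvd_mul_left (pow_pos hp.pos b) ?_
      rwa [← pow_add, Nat.add_sub_cancel' hab]
  obtain ⟨c, hc⟩ := h2
  exact ⟨c, by rw [← ZMod.natCast_zmod_val y, hc]; simp⟩

/-- A homomorphism `ℤ/p^{e j} → ℤ/p^{e i}` has image killed by `p^{e j}`, hence is divisible by
`p^{e i - e j}`; the subtraction is truncated, so nothing is gained when `e i ≤ e j`. -/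
lemma pow_dvd_map_single (hp : p.Prime) (ψ : StdGroup p e →+ StdGroup p e) (i j : Fin n)
    {x : ZMod (p ^ e j)} {c : ℕ} (hx : (p : ZMod (p ^ e j)) ^ c ∣ x) :
    (p : ZMod (p ^ e i)) ^ (c + (e i - e j)) ∣ ψ (Pi.single j x) i := by
  obtain ⟨z, rfl⟩ := hx
  have h1 : (p : ZMod (p ^ e j)) ^ c * z = p ^ c • z := by simp
  rw [h1, Pi.single_smul, map_nsmul, pow_add]
  have h2 : (p : ZMod (p ^ e i)) ^ (e i - e j) ∣ ψ (Pi.single j z) i := by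
    apply pow_dvd_of_pow_smul_eq_zero hp
    rw [← Pi.smul_apply, ← map_nsmul, ← Pi.single_smul]
    have : p ^ e j • z = 0 := by
      rw [nsmul_eq_mul, CharP.cast_eq_zero, zero_mul]
    simp [this]
  rw [Pi.smul_apply, nsmul_eq_mul]
  push_cast
  exact mul_dvd_mul_left _ h2

/-- Indices whose values are attained once and differ pairwise by at least two. -/
def Spaced (e : Fin n → ℕ) (T : Finset (Fin n)) : Prop :=
  ∀ t ∈ T, ∀ j, j ≠ t → e j ≠ e t ∧ (j ∈ T → e j + 2 ≤ e t ∨ e t + 2 ≤ e j)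

lemma Spaced.mono {S T : Finset (Fin n)} (hT : Spaced e T) (h : S ⊆ T) : Spaced e S :=
  fun t ht j hj => ⟨(hT t (h ht) j hj).1, fun hjS => (hT t (h ht) j hj).2 (h hjS)⟩

/-- `e` is injective on `T`, so at most `c - a` elements of `T` have values in `[a, c)`. -/
lemma Spaced.card_filter_lt_le {T : Finset (Fin n)} (hT : Spaced e T) {a b c : ℕ}
    (h : ∀ t ∈ T, e t < b → e t < c) :
    #{t ∈ T | e t < b} ≤ #{t ∈ T | e t < a} + (c - a) := by
  have h1 : ({t ∈ T | e t < b} : Finset (Fin n)) ⊆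
      {t ∈ T | e t < a} ∪ {t ∈ T | a ≤ e t ∧ e t < c} := by
    intro t ht
    simp only [mem_union, mem_filter] at ht ⊢
    have := h t ht.1 ht.2
    rcases lt_or_ge (e t) a with h2 | h2
    · exact Or.inl ⟨ht.1, h2⟩
    · exact Or.inr ⟨ht.1, h2, this⟩
  refine (card_le_card h1).trans ((card_union_le _ _).trans (Nat.add_le_add_left ?_ _))
  rw [← Nat.card_Ico]
  refine card_le_card_of_injOn e (fun t ht => ?_) fun t ht s hs hts => ?_
  · simpa using (mem_filter.mp ht).2
  · by_contra hne
    exact (hT s (mem_filter.mp hs).1 t hne).1 hts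

lemma pow_card_le_card_ker (hp : p.Prime) (he : ∀ i, 1 ≤ e i) {T : Finset (Fin n)}
    (hT : Spaced e T) (ψ : StdGroup p e →+ StdGroup p e)
    (hψ : ∀ t ∈ T, (p : ZMod (p ^ e t)) ∣ ψ (Pi.single t 1) t) :
    p ^ #T ≤ Nat.card ψ.ker := by
  have : ∀ i, NeZero (p ^ e i) := fun i => ⟨(pow_pos hp.pos _).ne'⟩
  -- The subgroup for `g` has index `p ^ #T` in the one for `f`; it remains to see that `ψ` maps the
  -- latter into the former.
  set f : Fin n → ℕ := fun i => #{t ∈ T | e t < e i} with hf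
  set g : Fin n → ℕ := fun i => f i + if i ∈ T then 1 else 0 with hg
  have hfe : ∀ i, f i + 1 ≤ e i := fun i => by
    have h0 : #{t ∈ T | e t < 1} = 0 := by
      rw [card_eq_zero, filter_eq_empty_iff]
      intro t _
      have := he t
      omega
    have := hT.card_filter_lt_le (a := 1) (b := e i) (c := e i) fun _ _ h => h
    have := he i
    simp only [hf]
    omega
  have hge : ∀ i, g i ≤ e i := fun i => by
    have := hfe i
    simp only [hg]
    split_ifs <;> omega
  have hmap : ∀ x ∈ divSubgroup p e f, ψ x ∈ divSubgroup p e g := by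
    intro x hx i
    rw [map_apply_eq_sum]
    refine dvd_sum fun j _ => ?_
    have hd := pow_dvd_map_single hp ψ i j (hx j)
    have hmono : f i ≤ f j + (e i - e j) := hT.card_filter_lt_le fun _ _ h => h
    by_cases hi : i ∈ T
    · have hgi : g i = f i + 1 := by simp [hg, hi]
      rcases eq_or_ne j i with rfl | hji
      · rw [hgi, map_single_eq hp, Pi.smul_apply, nsmul_eq_mul, pow_succ,
          ZMod.natCast_zmod_val]
        exact mul_dvd_mul (hx j) (hψ j hi)
      · refine (pow_dvd_pow _ ?_).trans hd
        rw [hgi]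
        have hne := (hT i hi j hji).1
        rcases lt_or_gt_of_ne hne with hlt | hgt
        -- The gap of 2 means that no element of `T` has value `e i - 1`, which saves the extra
        -- power of `p`.
        · have := hT.card_filter_lt_le (a := e j) (b := e i) (c := e i - 1) fun t ht h => by
            rcases eq_or_ne t i with rfl | hti
            · omega
            · have := (hT i hi t hti).2 ht
              omega
          change f i ≤ f j + _ at this
          omega
        -- Here `i` itself is counted by `f j` but not by `f i`.
        · have : f i < f j := by
            refine card_lt_card ⟨fun t ht => ?_, fun h => ?_⟩
            · rw [mem_filter] at ht ⊢
              exact ⟨ht.1, ht.2.trans hgt⟩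
            · have := h (mem_filter.mpr ⟨hi, hgt⟩)
              simp at this
          omega
    · refine (pow_dvd_pow _ ?_).trans hd
      simpa [hg, hi] using hmono
  have h1 := card_le_card_ker_mul ψ hmap
  rw [card_divSubgroup hp fun i => (Nat.le_succ _).trans (hfe i), card_divSubgroup hp hge] at h1
  have h2 : ∑ i, (e i - f i) = #T + ∑ i, (e i - g i) := by
    have h3 : #T = ∑ i, if i ∈ T then 1 else 0 := by simp
    rw [h3, ← sum_add_distrib]
    refine sum_congr rfl fun i _ => ?_
    have := hfe i
    simp only [hg]
    split_ifs <;> omega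
  rw [h2, pow_add] at h1
  exact Nat.le_of_mul_le_mul_right h1 (pow_pos hp.pos _)

lemma exists_smulSubOne_diag (hp : p.Prime) (he : ∀ i, 1 ≤ e i) (φ : StdGroup p e ≃+ StdGroup p e)
    {t : Fin n} (ht : ∀ j, j ≠ t → e j ≠ e t) :
    ∃ k ∈ Icc 1 (p - 1),
      (p : ZMod (p ^ e t)) ∣ smulSubOne k φ.toAddMonoidHom (Pi.single t 1) t := by
  have : ∀ i, NeZero (p ^ e i) := fun i => ⟨(pow_pos hp.pos _).ne'⟩
  set y : StdGroup p e := φ.symm (Pi.single t 1) with hy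
  have h1 : φ.toAddMonoidHom y t = 1 := by simp [hy]
  rw [map_apply_eq_sum, ← add_sum_erase _ _ (mem_univ t), map_single_eq hp] at h1
  set a := φ.toAddMonoidHom (Pi.single t 1) t with ha
  -- Since `e j ≠ e t`, one of `e j - e t` and `e t - e j` is positive: either `y j` or the entry of
  -- `φ` from `j` to `t` is divisible by `p`. Thus `y t` inverts the diagonal entry mod `p`, and its
  -- residue is the required `k`.
  have hsum : (p : ZMod (p ^ e t)) ∣
      ∑ j ∈ univ.erase t, φ.toAddMonoidHom (Pi.single j (y j)) t := by
    refine dvd_sum fun j hj => ?_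
    have hj := (mem_erase.mp hj).1
    have hyj : (p : ZMod (p ^ e j)) ^ (0 + (e j - e t)) ∣ y j :=
      pow_dvd_map_single hp φ.symm.toAddMonoidHom j t (x := 1) (by simp)
    have := pow_dvd_map_single hp φ.toAddMonoidHom t j hyj
    refine (dvd_pow_self _ ?_).trans this
    have := ht j hj
    omega
  have h2 : (p : ZMod (p ^ e t)) ∣ (y t).val * a - 1 := by
    rw [← h1, Pi.smul_apply, nsmul_eq_mul, sub_add_cancel_left]
    exact (dvd_neg).mpr hsum
  have hmod : (p : ZMod (p ^ e t)) ∣ ((y t).val % p : ℕ) * a - 1 := by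
    have h3 : (((y t).val : ℕ) : ZMod (p ^ e t)) =
        p * ((y t).val / p : ℕ) + ((y t).val % p : ℕ) := by
      exact_mod_cast congrArg (Nat.cast : ℕ → ZMod (p ^ e t)) (Nat.div_add_mod _ _).symm
    rw [h3, add_mul, add_sub_assoc, mul_assoc] at h2
    exact (dvd_add_right (dvd_mul_right _ _)).mp h2
  refine ⟨(y t).val % p, ?_, ?_⟩
  · rw [mem_Icc]
    have := Nat.mod_lt (y t).val hp.pos
    refine ⟨Nat.one_le_iff_ne_zero.mpr fun h0 => ?_, by omega⟩
    rw [h0, Nat.cast_zero, zero_mul, zero_sub, dvd_neg] at hmod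
    have hu : IsUnit ((p : ℕ) : ZMod (p ^ e t)) := isUnit_of_dvd_one hmod
    rw [ZMod.isUnit_iff_coprime] at hu
    have := (Nat.coprime_pow_right_iff (he t) _ _).mp hu
    rw [Nat.coprime_self] at this
    exact hp.one_lt.ne' this
  · rw [smulSubOne_apply, Pi.sub_apply, Pi.smul_apply, nsmul_eq_mul, Pi.single_eq_same]
    exact hmod

lemma pow_card_le_prodFix (hp : p.Prime) (he : ∀ i, 1 ≤ e i) {T : Finset (Fin n)}
    (hT : Spaced e T) (φ : StdGroup p e ≃+ StdGroup p e) : p ^ #T ≤ prodFix p φ := by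
  have h : ∀ t : Fin n, ∃ k, t ∈ T → k ∈ Icc 1 (p - 1) ∧
      (p : ZMod (p ^ e t)) ∣ smulSubOne k φ.toAddMonoidHom (Pi.single t 1) t := fun t => by
    by_cases ht : t ∈ T
    · obtain ⟨k, hk⟩ := exists_smulSubOne_diag hp he φ fun j hj => (hT t ht j hj).1
      exact ⟨k, fun _ => hk⟩
    · exact ⟨0, fun h => absurd h ht⟩
  choose k hk using h
  rw [prodFix_eq, card_eq_sum_card_fiberwise (f := k) (t := Icc 1 (p - 1))
    fun t ht => (hk t ht).1, ← prod_pow_eq_pow_sum]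
  refine prod_le_prod' fun i _ => ?_
  refine pow_card_le_card_ker hp he (hT.mono (filter_subset _ _)) _ fun t ht => ?_
  obtain ⟨htT, rfl⟩ := mem_filter.mp ht
  exact (hk t htT).2

end LowerBound

/-! ### Automorphisms with prescribed `Π` on the building blocks. -/

section Construction

variable {p : ℕ} {P : Type*} [AddCommGroup P]

lemma prod_mem_prodSpec [Finite P] (θ : P →+ P) (h0 : ∀ x, θ x = 0 → x = 0) :
    ∏ k ∈ Icc 1 (p - 1), Nat.card (smulSubOne k θ).ker ∈ prodSpec p P := by
  have hinj : Function.Injective θ := (injective_iff_map_eq_zero θ).mpr h0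
  exact ⟨AddEquiv.ofBijective θ (Finite.injective_iff_bijective.mp hinj), prodFix_eq p _⟩

lemma one_mem_prodSpec [Finite P] (θ : P →+ P) (h0 : ∀ x, θ x = 0 → x = 0)
    (h : ∀ k : ℕ, ∀ x, k • θ x = x → x = 0) : 1 ∈ prodSpec p P := by
  convert prod_mem_prodSpec (p := p) θ h0
  refine (prod_eq_one fun k _ => ?_).symm
  rw [AddSubgroup.card_eq_one, AddMonoidHom.ker_eq_bot_iff, injective_iff_map_eq_zero]
  exact fun x hx => h k x (sub_eq_zero.mp hx)

/-- For `1 + ν`, the factor at `k = 1` is `|ker ν|`. For other `k`, `kν x = (1 - k)x` yields `(k²pc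
- (1 - k)²)x = 0` on applying `ν`, with a coefficient prime to `p`, so the factor is 1. -/
lemma card_ker_mem_prodSpec [Finite P] {N : ℕ} (hp : p.Prime) (hP : ∀ x : P, p ^ N • x = 0)
    (ν : P →+ P) (c : ℕ) (hν : ∀ x, ν (ν x) = (p * c) • x) :
    Nat.card ν.ker ∈ prodSpec p P := by
  have hp1 : Prime (p : ℤ) := Nat.prime_iff_prime_int.mp hp
  have h0 : ∀ x, (AddMonoidHom.id P + ν) x = 0 → x = 0 := by
    intro x hx
    have h1 : ν x = -x := (neg_eq_of_add_eq_zero_right hx).symm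
    have h2 := hν x
    rw [h1, map_neg, h1, neg_neg] at h2
    refine eq_zero_of_zsmul_eq_zero hp hP (k := p * c - 1) (fun hd => ?_) (x := x) ?_
    · exact hp1.not_dvd_one ((dvd_sub_right (dvd_mul_right _ _)).mp hd)
    · rw [sub_smul, one_smul, sub_eq_zero]
      nth_rewrite 2 [h2]
      exact_mod_cast natCast_zsmul x (p * c)
  convert prod_mem_prodSpec (p := p) _ h0
  have hker : ∀ k : ℕ, ∀ x,
      smulSubOne k (AddMonoidHom.id P + ν) x = k • ν x + ((k : ℤ) - 1) • x := by
    intro k x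
    simp only [smulSubOne_apply, AddMonoidHom.add_apply, AddMonoidHom.id_apply, smul_add, sub_smul,
      natCast_zsmul, one_smul]
    abel
  rw [prod_eq_single_of_mem 1 (mem_Icc.mpr ⟨le_rfl, by have := hp.two_le; omega⟩)]
  · refine Nat.card_congr (Equiv.subtypeEquivRight fun x => ?_)
    rw [AddMonoidHom.mem_ker, AddMonoidHom.mem_ker, hker]
    simp
  · intro k hk hk1
    rw [AddSubgroup.card_eq_one, AddMonoidHom.ker_eq_bot_iff, injective_iff_map_eq_zero]
    intro x hx
    rw [hker] at hx
    have h1 : (k : ℤ) • ν x = (1 - (k : ℤ)) • x := by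
      rw [natCast_zsmul, eq_neg_of_add_eq_zero_left hx, ← neg_smul, neg_sub]
    have h2 : ((k : ℤ) * k * (p * c) - (1 - k) * (1 - k)) • x = 0 := by
      have h3 : ν ((k : ℤ) • ν x) = ν ((1 - (k : ℤ)) • x) := by rw [h1]
      rw [map_zsmul, map_zsmul, hν] at h3
      linear_combination (norm := module) (k : ℤ) • h3 + (1 - (k : ℤ)) • h1
    refine eq_zero_of_zsmul_eq_zero hp hP (fun hd => ?_) h2
    have h3 : (p : ℤ) ∣ (1 - k) * (1 - k) :=
      (dvd_sub_right ((dvd_mul_right _ _).mul_left _)).mp hd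
    have h4 := (hp1.dvd_or_dvd h3).elim id id
    rw [mem_Icc] at hk
    have := Int.eq_zero_of_abs_lt_dvd h4 (by rw [abs_lt]; omega)
    omega

/-- Take `ν (x, y) = (β y, α x)`, whose square is `p`. -/
lemma card_ker_mul_mem_prodSpec {A B : Type*} [AddCommGroup A] [AddCommGroup B] [Finite A]
    [Finite B] {N : ℕ} (hp : p.Prime) (hA : ∀ x : A, p ^ N • x = 0) (hB : ∀ x : B, p ^ N • x = 0)
    (α : A →+ B) (β : B →+ A) (hβα : ∀ x, β (α x) = p • x) (hαβ : ∀ y, α (β y) = p • y) :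
    Nat.card α.ker * Nat.card β.ker ∈ prodSpec p (A × B) := by
  let ν : A × B →+ A × B := (β.comp (AddMonoidHom.snd A B)).prod (α.comp (AddMonoidHom.fst A B))
  convert card_ker_mem_prodSpec (N := N) hp (fun x : A × B => Prod.ext (hA x.1) (hB x.2)) ν 1
    fun x => by simp [ν, hβα, hαβ, Prod.ext_iff]
  rw [← Nat.card_prod]
  refine Nat.card_congr ((Equiv.subtypeEquivRight fun x => ?_).trans
    (Equiv.subtypeProdEquivProd (p := fun x => x ∈ α.ker) (q := fun x => x ∈ β.ker))).symm
  simp [ν, AddMonoidHom.mem_ker, and_comm]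

lemma zmod_pow_smul (p a : ℕ) (x : ZMod (p ^ a)) : p ^ a • x = 0 := by
  rw [nsmul_eq_mul, CharP.cast_eq_zero, zero_mul]

lemma card_pow_smul_eq_zero (hp : p.Prime) {a s : ℕ} (h : s ≤ a) :
    Nat.card {x : ZMod (p ^ a) // p ^ s • x = 0} = p ^ s := by
  have h1 : ∀ x : ZMod (p ^ a), p ^ s • x = 0 ↔ (p : ZMod (p ^ a)) ^ (a - s) ∣ x := by
    refine fun x => ⟨pow_dvd_of_pow_smul_eq_zero hp, ?_⟩
    rintro ⟨z, rfl⟩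
    rw [nsmul_eq_mul, Nat.cast_pow, ← mul_assoc, ← pow_add, Nat.add_sub_cancel' h,
      ← Nat.cast_pow, CharP.cast_eq_zero, zero_mul]
  rw [Nat.card_congr (Equiv.subtypeEquivRight h1), card_pow_dvd hp (Nat.sub_le _ _),
    Nat.sub_sub_self h]

/-- Take `ν = p ^ s`; `1 ≤ s` makes `ν²` a multiple of `p`. -/
lemma pow_mem_prodSpec_zmod (hp : p.Prime) {a s : ℕ} (hs : 1 ≤ s) (hsa : s ≤ a) :
    p ^ s ∈ prodSpec p (ZMod (p ^ a)) := by
  have : NeZero (p ^ a) := ⟨(pow_pos hp.pos _).ne'⟩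
  convert card_ker_mem_prodSpec hp (zmod_pow_smul p a) (nsmulAddMonoidHom (p ^ s))
    (p ^ (s - 1 + s)) (fun x => ?_)
  · exact (card_pow_smul_eq_zero hp hsa).symm
  · simp only [nsmulAddMonoidHom_apply, ← mul_smul, ← pow_add, ← pow_succ']
    congr 2
    omega

lemma self_mem_prodSpec_zmod_prod_self (hp : p.Prime) {a : ℕ} (ha : 1 ≤ a) :
    p ∈ prodSpec p (ZMod (p ^ a) × ZMod (p ^ a)) := by
  have : NeZero (p ^ a) := ⟨(pow_pos hp.pos _).ne'⟩
  convert card_ker_mul_mem_prodSpec hp (zmod_pow_smul p a) (zmod_pow_smul p a)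
    (nsmulAddMonoidHom p) (AddMonoidHom.id _) (fun _ => rfl) fun _ => rfl
  have h := card_pow_smul_eq_zero hp ha
  rw [pow_one] at h
  have h1 : Nat.card (nsmulAddMonoidHom p : ZMod (p ^ a) →+ _).ker = p := h
  rw [h1, AddMonoidHom.ker_id, AddSubgroup.card_bot, mul_one]

/-- Here `β` is reduction, with kernel of order `p`, and `α` is the embedding induced by
multiplication by `p`. -/
lemma self_mem_prodSpec_zmod_prod_succ (hp : p.Prime) (a : ℕ) :
    p ∈ prodSpec p (ZMod (p ^ a) × ZMod (p ^ (a + 1))) := by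
  have : ∀ a, NeZero (p ^ a) := fun a => ⟨(pow_pos hp.pos _).ne'⟩
  let β : ZMod (p ^ (a + 1)) →+ ZMod (p ^ a) :=
    (ZMod.castHom (pow_dvd_pow p a.le_succ) (ZMod (p ^ a))).toAddMonoidHom
  let α : ZMod (p ^ a) →+ ZMod (p ^ (a + 1)) :=
    ZMod.lift (p ^ a) ⟨(AddMonoidHom.mulLeft (p : ZMod (p ^ (a + 1)))).comp
      (Int.castAddHom (ZMod (p ^ (a + 1)))), by
        have h : (p : ZMod (p ^ (a + 1))) * (p : ZMod (p ^ (a + 1))) ^ a = 0 := by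
          rw [← pow_succ', ← Nat.cast_pow, CharP.cast_eq_zero]
        simpa using h⟩
  have hβ : Function.Surjective β := ZMod.castHom_surjective (pow_dvd_pow p a.le_succ)
  have hαβ : ∀ y, α (β y) = p • y := by
    intro y
    obtain ⟨z, rfl⟩ := ZMod.intCast_surjective y
    have h1 : β (z : ZMod (p ^ (a + 1))) = (z : ZMod (p ^ a)) :=
      map_intCast (ZMod.castHom (pow_dvd_pow p a.le_succ) (ZMod (p ^ a))) z
    rw [h1, ZMod.lift_coe]
    simp
  have hβα : ∀ x, β (α x) = p • x := by
    intro x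
    obtain ⟨y, rfl⟩ := hβ x
    rw [hαβ, map_nsmul]
  convert card_ker_mul_mem_prodSpec (N := a + 1) hp
    (fun x => by rw [pow_succ', mul_smul, zmod_pow_smul, smul_zero])
    (zmod_pow_smul p (a + 1)) α β hβα hαβ
  have hα : α.ker = ⊥ := by
    rw [AddMonoidHom.ker_eq_bot_iff, injective_iff_map_eq_zero]
    intro x hx
    obtain ⟨y, rfl⟩ := hβ x
    rw [hαβ] at hx
    obtain ⟨z, rfl⟩ := pow_dvd_of_pow_smul_eq_zero (a := a + 1) (b := 1) (y := y) hp
      (by rwa [pow_one])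
    have h1 : (p : ZMod (p ^ (a + 1))) ^ (a + 1 - 1) * z = p ^ a • z := by simp
    rw [h1, map_nsmul, zmod_pow_smul]
  have hc := β.ker.card_mul_index
  rw [AddSubgroup.index_ker, AddMonoidHom.range_eq_top.mpr hβ, AddSubgroup.card_top,
    Nat.card_zmod, Nat.card_zmod] at hc
  rw [hα, AddSubgroup.card_bot, one_mul]
  exact (Nat.eq_of_mul_eq_mul_right (pow_pos hp.pos a)
    (hc.trans (pow_succ' p a))).symm

/-- The map `x ↦ x^{m+1} - x^m` on `ZMod p` takes `0` and `1` to `0`, so it misses some `u`; a root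
`k` would give `u` as the value at `k⁻¹`. -/
lemma exists_no_root (hp : p.Prime) {m : ℕ} (hm : m ≠ 0) :
    ∃ u : ℕ, ¬ (p : ℤ) ∣ u ∧ ∀ k : ℕ, ¬ (p : ℤ) ∣ k ^ (m + 1) * u + k - 1 := by
  have : Fact p.Prime := ⟨hp⟩
  let g : ZMod p → ZMod p := fun x => x ^ (m + 1) - x ^ m
  have hg : ¬ Function.Surjective g := by
    rw [← Finite.injective_iff_surjective]
    intro h
    exact zero_ne_one (h (by simp [g, hm]) : (0 : ZMod p) = 1)
  rw [Function.Surjective, not_forall] at hg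
  obtain ⟨u, hu⟩ := hg
  refine ⟨u.val, ?_, fun k => ?_⟩ <;> rw [← ZMod.intCast_zmod_eq_zero_iff_dvd] <;> push_cast <;>
    rw [ZMod.natCast_zmod_val]
  · rintro rfl
    exact hu ⟨0, by simp [g, hm]⟩
  · intro h
    have hk : (k : ZMod p) ≠ 0 := by
      intro hk
      simp [hk] at h
    refine hu ⟨(k : ZMod p)⁻¹, ?_⟩
    simp only [g, pow_succ] at h ⊢
    have h1 : (k : ZMod p) ^ m * (k : ZMod p)⁻¹ ^ m = 1 := by
      rw [← mul_pow, mul_inv_cancel₀ hk, one_pow]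
    have h2 : (k : ZMod p) * (k : ZMod p)⁻¹ = 1 := mul_inv_cancel₀ hk
    generalize (k : ZMod p)⁻¹ = l at h1 h2 ⊢
    linear_combination -l ^ m * l * h + u * k * l * h1 + (u + l ^ m) * h2

lemma one_mem_prodSpec_sq {A : Type*} [AddCommGroup A] [Finite A] {N : ℕ} (hp : p.Prime)
    (hA : ∀ x : A, p ^ N • x = 0) : 1 ∈ prodSpec p (A × A) := by
  obtain ⟨u, hu, hk⟩ := exists_no_root hp one_ne_zero
  -- A companion map: `kθ` fixing a vector forces `(k²u + k - 1) y = 0`.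
  let θ : A × A →+ A × A := (AddMonoidHom.snd A A).prod
    ((u • AddMonoidHom.fst A A) + AddMonoidHom.snd A A)
  refine one_mem_prodSpec θ ?_ fun k => ?_
  · rintro ⟨x, y⟩ h
    simp only [θ, Prod.ext_iff] at h
    obtain ⟨h1, h2⟩ := h
    change y = 0 at h1
    change u • x + y = 0 at h2
    subst h1
    rw [add_zero, ← natCast_zsmul] at h2
    rw [eq_zero_of_zsmul_eq_zero hp hA hu h2]
    rfl
  · rintro ⟨x, y⟩ h
    simp only [θ, Prod.ext_iff] at h
    obtain ⟨h1, h2⟩ := h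
    change k • y = x at h1
    change k • (u • x + y) = y at h2
    subst h1
    have h3 : ((k : ℤ) ^ 2 * u + k - 1) • y = 0 := by
      linear_combination (norm := module) h2
    rw [eq_zero_of_zsmul_eq_zero hp hA (hk k) h3, smul_zero]
    rfl

lemma one_mem_prodSpec_cube {A : Type*} [AddCommGroup A] [Finite A] {N : ℕ} (hp : p.Prime)
    (hA : ∀ x : A, p ^ N • x = 0) : 1 ∈ prodSpec p (A × A × A) := by
  obtain ⟨u, hu, hk⟩ := exists_no_root hp two_ne_zero
  let θ : A × A × A →+ A × A × A :=
    ((AddMonoidHom.fst A A).comp (AddMonoidHom.snd A (A × A))).prod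
      (((AddMonoidHom.snd A A).comp (AddMonoidHom.snd A (A × A))).prod
        ((u • AddMonoidHom.fst A (A × A)) +
          (AddMonoidHom.snd A A).comp (AddMonoidHom.snd A (A × A))))
  refine one_mem_prodSpec θ ?_ fun k => ?_
  · rintro ⟨x, y, z⟩ h
    simp only [θ, Prod.ext_iff] at h
    obtain ⟨h1, h2, h3⟩ := h
    change y = 0 at h1
    change z = 0 at h2
    change u • x + z = 0 at h3
    subst h1 h2
    rw [add_zero, ← natCast_zsmul] at h3
    rw [eq_zero_of_zsmul_eq_zero hp hA hu h3]
    rfl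
  · rintro ⟨x, y, z⟩ h
    simp only [θ, Prod.ext_iff] at h
    obtain ⟨h1, h2, h3⟩ := h
    change k • y = x at h1
    change k • z = y at h2
    change k • (u • x + z) = z at h3
    subst h2
    subst h1
    have h4 : ((k : ℤ) ^ 3 * u + k - 1) • z = 0 := by
      linear_combination (norm := module) h3
    rw [eq_zero_of_zsmul_eq_zero hp hA (hk k) h4, smul_zero, smul_zero]
    rfl

end Construction

/-! ### Gluing intervals of exponents along disjoint index sets. -/

section Assembly

variable {p n : ℕ} {e : Fin n → ℕ}

/-- The direct factor of the standard group spanned by the coordinates in `s`. -/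
abbrev Factor (p : ℕ) {n : ℕ} (e : Fin n → ℕ) (s : Finset (Fin n)) : Type :=
  ∀ i : s, ZMod (p ^ e i)

/-- Every power of `p` with exponent in `[a, ∑ i ∈ s, e i]` is a value of `Π` on the factor
attached to `s`. -/
def Realizes (p : ℕ) {n : ℕ} (e : Fin n → ℕ) (s : Finset (Fin n)) (a : ℕ) : Prop :=
  a ≤ ∑ i ∈ s, e i ∧ ∀ m, a ≤ m → m ≤ ∑ i ∈ s, e i → p ^ m ∈ prodSpec p (Factor p e s)

lemma nonempty_factor_union {s t : Finset (Fin n)} (h : Disjoint s t) :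
    Nonempty (Factor p e (s ∪ t) ≃+ Factor p e s × Factor p e t) := by
  let θ : Factor p e (s ∪ t) →+ Factor p e s × Factor p e t :=
    { toFun := fun x => (fun i => x ⟨i, mem_union_left _ i.2⟩,
        fun i => x ⟨i, mem_union_right _ i.2⟩)
      map_zero' := rfl
      map_add' := fun _ _ => rfl }
  refine ⟨AddEquiv.ofBijective θ ⟨fun x y hxy => ?_, fun ⟨x, y⟩ => ?_⟩⟩
  · ext ⟨i, hi⟩
    rcases mem_union.mp hi with his | hit
    · exact congrFun (congrArg Prod.fst hxy) ⟨i, his⟩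
    · exact congrFun (congrArg Prod.snd hxy) ⟨i, hit⟩
  · refine ⟨fun i => if hi : (i : Fin n) ∈ s then x ⟨i, hi⟩ else
      y ⟨i, (mem_union.mp i.2).resolve_left hi⟩, Prod.ext ?_ ?_⟩
    · ext i
      simp [θ]
    · ext i
      have hi : (i : Fin n) ∉ s := fun h' => disjoint_left.mp h h' i.2
      simp [θ, hi]

lemma nonempty_factor_singleton (p : ℕ) (e : Fin n → ℕ) (k : Fin n) :
    Nonempty (Factor p e {k} ≃+ ZMod (p ^ e k)) := by
  let θ : Factor p e {k} →+ ZMod (p ^ e k) :=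
    { toFun := fun x => x ⟨k, mem_singleton_self k⟩
      map_zero' := rfl
      map_add' := fun _ _ => rfl }
  refine ⟨AddEquiv.ofBijective θ ⟨fun x y hxy => ?_, fun y => ?_⟩⟩
  · ext ⟨i, hi⟩
    obtain rfl := mem_singleton.mp hi
    exact hxy
  · exact ⟨fun i => (Pi.single k y : StdGroup p e) i, by simp [θ]⟩

lemma nonempty_factor_pair {k l : Fin n} (h : k ≠ l) :
    Nonempty (Factor p e {k, l} ≃+ ZMod (p ^ e k) × ZMod (p ^ e l)) := by
  obtain ⟨f⟩ := nonempty_factor_union (p := p) (e := e) (disjoint_singleton.mpr h)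
  obtain ⟨g⟩ := nonempty_factor_singleton p e k
  obtain ⟨g'⟩ := nonempty_factor_singleton p e l
  exact ⟨f.trans (g.prodCongr g')⟩

lemma Realizes.union {s t : Finset (Fin n)} {a b : ℕ} (hs : Realizes p e s a)
    (ht : Realizes p e t b) (h : Disjoint s t) : Realizes p e (s ∪ t) (a + b) := by
  obtain ⟨f⟩ := nonempty_factor_union (p := p) (e := e) h
  rw [Realizes, sum_union h, prodSpec_congr p f]
  refine ⟨add_le_add hs.1 ht.1, fun m h1 h2 => ?_⟩
  have h3 := hs.1
  have h4 := ht.1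
  -- Give the first factor as much as possible while leaving at least `b` for the second.
  obtain ⟨c, d, rfl, hc⟩ : ∃ c d, m = c + d ∧ (a ≤ c ∧ c ≤ ∑ i ∈ s, e i ∧ b ≤ d ∧
      d ≤ ∑ i ∈ t, e i) :=
    ⟨min (∑ i ∈ s, e i) (m - b), m - min (∑ i ∈ s, e i) (m - b), by omega, by omega⟩
  rw [pow_add]
  exact mul_mem_prodSpec_prod p (hs.2 c hc.1 hc.2.1) (ht.2 d hc.2.2.1 hc.2.2.2)

lemma realizes_empty (p : ℕ) (e : Fin n → ℕ) : Realizes p e ∅ 0 := by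
  refine ⟨le_rfl.trans (Nat.zero_le _), fun m _ h => ?_⟩
  obtain rfl : m = 0 := by simpa using h
  exact one_mem_prodSpec (AddMonoidHom.id _) (fun x _ => Subsingleton.elim _ _)
    fun _ x _ => Subsingleton.elim _ _

lemma Realizes.biUnion {ι : Type*} [DecidableEq ι] (I : Finset ι) {s : ι → Finset (Fin n)}
    {a : ι → ℕ} (h : ∀ i ∈ I, Realizes p e (s i) (a i))
    (hd : ∀ i ∈ I, ∀ j ∈ I, i ≠ j → Disjoint (s i) (s j)) :
    Realizes p e (I.biUnion s) (∑ i ∈ I, a i) := by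
  induction I using Finset.induction_on with
  | empty => exact realizes_empty p e
  | insert i I hi ih =>
    rw [biUnion_insert, sum_insert hi]
    refine (h i (mem_insert_self _ _)).union (ih (fun j hj => h j (mem_insert_of_mem hj))
      fun j hj k hk => hd j (mem_insert_of_mem hj) k (mem_insert_of_mem hk)) ?_
    rw [disjoint_biUnion_right]
    exact fun j hj => hd i (mem_insert_self _ _) j (mem_insert_of_mem hj)
      (ne_of_mem_of_not_mem hj hi).symm

lemma realizes_singleton (hp : p.Prime) (he : ∀ i, 1 ≤ e i) (k : Fin n) :
    Realizes p e {k} 1 := by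
  obtain ⟨f⟩ := nonempty_factor_singleton p e k
  rw [Realizes, prodSpec_congr p f, sum_singleton]
  exact ⟨he k, fun m => pow_mem_prodSpec_zmod hp⟩

lemma Realizes.of_succ {s : Finset (Fin n)} {a : ℕ} (h : Realizes p e s (a + 1))
    (ha : p ^ a ∈ prodSpec p (Factor p e s)) : Realizes p e s a := by
  refine ⟨(Nat.le_succ a).trans h.1, fun m h1 h2 => ?_⟩
  rcases h1.eq_or_lt with rfl | h1
  · exact ha
  · exact h.2 m h1 h2

lemma realizes_pair_two (hp : p.Prime) (he : ∀ i, 1 ≤ e i) {k l : Fin n} (h : k ≠ l) :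
    Realizes p e {k, l} 2 :=
  (realizes_singleton hp he k).union (realizes_singleton hp he l) (disjoint_singleton.mpr h)

lemma realizes_pair_succ (hp : p.Prime) (he : ∀ i, 1 ≤ e i) {k l : Fin n} (h : e l = e k + 1) :
    Realizes p e {k, l} 1 := by
  have hkl : k ≠ l := by
    rintro rfl
    omega
  refine (realizes_pair_two hp he hkl).of_succ ?_
  obtain ⟨f⟩ := nonempty_factor_pair (p := p) (e := e) hkl
  rw [prodSpec_congr p f, h, pow_one]
  exact self_mem_prodSpec_zmod_prod_succ hp _

lemma realizes_pair_eq (hp : p.Prime) (he : ∀ i, 1 ≤ e i) {k l : Fin n} (hkl : k ≠ l)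
    (h : e l = e k) : Realizes p e {k, l} 0 := by
  have : NeZero (p ^ e k) := ⟨(pow_pos hp.pos _).ne'⟩
  obtain ⟨f⟩ := nonempty_factor_pair (p := p) (e := e) hkl
  refine ((realizes_pair_two hp he hkl).of_succ ?_).of_succ ?_ <;> rw [prodSpec_congr p f, h]
  · rw [pow_one]
    exact self_mem_prodSpec_zmod_prod_self hp (he k)
  · exact one_mem_prodSpec_sq hp (zmod_pow_smul p (e k))

/-- A singleton and a pair already give every exponent from 1 on; only exponent 0 needs the cubic
companion map. -/
lemma realizes_triple_eq (hp : p.Prime) (he : ∀ i, 1 ≤ e i) {j k l : Fin n} (hjk : j ≠ k)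
    (hjl : j ≠ l) (hkl : k ≠ l) (hk : e k = e j) (hl : e l = e j) :
    Realizes p e {j, k, l} 0 := by
  have : NeZero (p ^ e j) := ⟨(pow_pos hp.pos _).ne'⟩
  have hd : Disjoint ({j} : Finset (Fin n)) {k, l} := by simp [hjk, hjl]
  refine ((realizes_singleton hp he j).union
    (realizes_pair_eq hp he hkl (hl.trans hk.symm)) hd).of_succ ?_
  obtain ⟨f⟩ := nonempty_factor_union (p := p) (e := e) hd
  obtain ⟨g⟩ := nonempty_factor_singleton p e j
  obtain ⟨g'⟩ := nonempty_factor_pair (p := p) (e := e) hkl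
  rw [prodSpec_congr p (f.trans (g.prodCongr g')), hk, hl]
  exact one_mem_prodSpec_cube hp (zmod_pow_smul p (e j))

lemma realizes_of_const (hp : p.Prime) (he : ∀ i, 1 ≤ e i) {v : ℕ} (s : Finset (Fin n))
    (hs : 2 ≤ #s) (hv : ∀ i ∈ s, e i = v) : Realizes p e s 0 := by
  induction s using Finset.strongInduction with
  | H s ih =>
    rcases hs.eq_or_lt with h2 | h2
    · obtain ⟨k, l, hkl, rfl⟩ := card_eq_two.mp h2.symm
      exact realizes_pair_eq hp he hkl (by rw [hv l (by simp), hv k (by simp)])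
    rcases (Nat.succ_le_of_lt h2).eq_or_lt with h3 | h3
    · obtain ⟨j, k, l, hjk, hjl, hkl, rfl⟩ := card_eq_three.mp h3.symm
      exact realizes_triple_eq hp he hjk hjl hkl (by rw [hv k (by simp), hv j (by simp)])
        (by rw [hv l (by simp), hv j (by simp)])
    -- With at least four elements, split off a pair; at least two remain.
    · obtain ⟨t, hts, ht⟩ := exists_subset_card_eq hs
      have hc := card_sdiff_add_card_eq_card hts
      have h1 : t ⊂ s := hts.ssubset_of_ne (by rintro rfl; omega)
      have h4 : s \ t ⊂ s := sdiff_subset.ssubset_of_ne (by intro h; rw [h] at hc; omega)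
      have := (ih t h1 ht.ge fun i hi => hv i (hts hi)).union
        (ih (s \ t) h4 (by omega) fun i hi => hv i (sdiff_subset hi)) disjoint_sdiff
      rwa [union_sdiff_of_subset hts] at this

end Assembly

/-! ### Combinatorics of the block decomposition. -/

section Blocks

variable {p n : ℕ} {e : Fin n → ℕ}

lemma IsBStart.candidate {k : ℕ} (h : IsBStart e k) : IsBCandidate e k := by
  cases k with
  | zero => exact h
  | succ k => exact h.1

lemma IsBStart.not_succ {k : ℕ} (h : IsBStart e k) : ¬ IsBStart e (k + 1) := fun h' => h'.2 h

lemma InB.not_inA {i : Fin n} (h : InB e i) : ¬ InA e i := by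
  rcases h with h | ⟨k, hk, h⟩
  · exact h.candidate.2.1
  · obtain ⟨h1, -, h2, -⟩ := h.candidate
    have : i = ⟨k + 1, h1⟩ := Fin.ext hk.symm
    rwa [this]

lemma InB.of_candidate {i : Fin n} (h : IsBCandidate e i) : InB e i := by
  by_cases hs : IsBStart e i
  · exact Or.inl hs
  · right
    obtain ⟨i, hi⟩ := i
    cases i with
    | zero => exact absurd h hs
    | succ k => exact ⟨k, rfl, by_contra fun hk => hs ⟨h, hk⟩⟩

open Classical in
/-- The first entries of the `b`-blocks. -/
noncomputable def bStarts (e : Fin n → ℕ) : Finset (Fin n) := {i | IsBStart e i}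

open Classical in
/-- The entries of the `c`-blocks. -/
noncomputable def cEntries (e : Fin n → ℕ) : Finset (Fin n) := {i | ¬ InA e i ∧ ¬ InB e i}

@[simp] lemma mem_bStarts {i : Fin n} : i ∈ bStarts e ↔ IsBStart e i := by simp [bStarts]

@[simp] lemma mem_cEntries {i : Fin n} : i ∈ cEntries e ↔ ¬ InA e i ∧ ¬ InB e i := by
  simp [cEntries]

lemma card_bStarts (e : Fin n → ℕ) : #(bStarts e) = bCount e :=
  (Nat.subtype_card _ fun _ => mem_bStarts).symm

lemma card_cEntries (e : Fin n → ℕ) : #(cEntries e) = cCount e :=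
  (Nat.subtype_card _ fun _ => mem_cEntries).symm

lemma disjoint_bStarts_cEntries (e : Fin n → ℕ) : Disjoint (bStarts e) (cEntries e) := by
  rw [disjoint_left]
  intro i hi hc
  exact (mem_cEntries.mp hc).2 (Or.inl (mem_bStarts.mp hi))

/-- Two entries violating the gap would be adjacent and form a candidate pair. The first, lying in a
`b`-block, would have to start it, so the second would already be used. -/
lemma spaced_bStarts_union_cEntries (hm : Monotone e) :
    Spaced e (bStarts e ∪ cEntries e) := by
  have hA : ∀ t ∈ bStarts e ∪ cEntries e, ¬ InA e t := by
    intro t ht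
    rcases mem_union.mp ht with h | h
    · exact InB.not_inA (Or.inl (mem_bStarts.mp h))
    · exact (mem_cEntries.mp h).1
  have hne : ∀ t ∈ bStarts e ∪ cEntries e, ∀ j, j ≠ t → e j ≠ e t :=
    fun t ht j hj h => hA t ht ⟨j, hj, h⟩
  have key : ∀ j ∈ bStarts e ∪ cEntries e, ∀ t ∈ bStarts e ∪ cEntries e, j < t →
      e j + 2 ≤ e t := by
    intro j hj t ht hjt
    by_contra hlt
    have h1 : e j ≤ e t := hm hjt.le
    have h2 := hne t ht j hjt.ne
    have h3 : (t : ℕ) = j + 1 := by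
      by_contra h4
      have h5 : (j : ℕ) < t := hjt
      have h6 : (j : ℕ) + 1 < n := by omega
      let i : Fin n := ⟨j + 1, h6⟩
      have hji : j < i := Fin.lt_def.mpr (Nat.lt_succ_self _)
      have hit : i < t := Fin.lt_def.mpr (by change (j : ℕ) + 1 < t; omega)
      have h7 := hne t ht i hit.ne
      have h8 := hne j hj i hji.ne'
      have h9 := hm hji.le
      have h10 := hm hit.le
      omega
    have ht' : t = ⟨j + 1, h3 ▸ t.2⟩ := Fin.ext h3
    have hcand : IsBCandidate e j :=
      ⟨h3 ▸ t.2, hA j hj, ht' ▸ hA t ht, by rw [← ht']; change e t = e j + 1; omega⟩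
    have hjs : IsBStart e j := by
      rcases mem_union.mp hj with h | h
      · exact mem_bStarts.mp h
      · exact absurd (InB.of_candidate hcand) (mem_cEntries.mp h).2
    rcases mem_union.mp ht with h | h
    · rw [mem_bStarts, h3] at h
      exact hjs.not_succ h
    · exact (mem_cEntries.mp h).2 (Or.inr ⟨j, h3.symm, hjs⟩)
  intro t ht j hj
  refine ⟨hne t ht j hj, fun hjT => ?_⟩
  rcases lt_or_gt_of_ne hj with h | h
  · exact Or.inl (key j hjT t ht h)
  · exact Or.inr (key t ht j hjT h)

/-- The entries at the positions `k` and `k + 1`. -/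
def pairAt (k : Fin n) : Finset (Fin n) := {i | i = k ∨ (i : ℕ) = k + 1}

@[simp] lemma mem_pairAt {i k : Fin n} : i ∈ pairAt k ↔ i = k ∨ (i : ℕ) = k + 1 := by
  simp [pairAt]

lemma realizes_pairAt (hp : p.Prime) (he : ∀ i, 1 ≤ e i) {k : Fin n} (h : IsBStart e k) :
    Realizes p e (pairAt k) 1 := by
  obtain ⟨h1, -, -, h2⟩ := h.candidate
  have h3 : pairAt k = {k, ⟨k + 1, h1⟩} := by
    ext i
    simp [Fin.ext_iff]
  rw [h3]
  exact realizes_pair_succ hp he h2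

lemma disjoint_pairAt {k l : Fin n} (hk : IsBStart e k) (hl : IsBStart e l) (h : k ≠ l) :
    Disjoint (pairAt k) (pairAt l) := by
  rw [disjoint_left]
  intro i hik hil
  rw [mem_pairAt] at hik hil
  rcases hik with rfl | hik <;> rcases hil with rfl | hil
  · exact h rfl
  · rw [hil] at hk
    exact hl.not_succ hk
  · rw [hik] at hl
    exact hk.not_succ hl
  · exact h (Fin.ext (by omega))

open Classical in
lemma realizes_univ (hp : p.Prime) (he : ∀ i, 1 ≤ e i) :
    Realizes p e univ (bCount e + cCount e) := by
  have hAr : Realizes p e (({i | InA e i} : Finset (Fin n)).image e |>.biUnion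
      fun v => ({i | e i = v} : Finset (Fin n)))
      (∑ _v ∈ ({i | InA e i} : Finset (Fin n)).image e, 0) := by
    refine Realizes.biUnion _ (fun v hv => ?_) fun v _ w _ hvw => ?_
    · obtain ⟨i, hi, rfl⟩ := mem_image.mp hv
      obtain ⟨j, hj, hji⟩ := (mem_filter.mp hi).2
      refine realizes_of_const hp he (v := e i) _ ?_ (by simp)
      exact one_lt_card.mpr ⟨j, by simp [hji], i, by simp, hj⟩
    · rw [disjoint_left]
      intro i hi hi'
      exact hvw ((mem_filter.mp hi).2.symm.trans (mem_filter.mp hi').2)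
  have hBr : Realizes p e ((bStarts e).biUnion pairAt) (∑ _k ∈ bStarts e, 1) :=
    Realizes.biUnion _ (fun k hk => realizes_pairAt hp he (mem_bStarts.mp hk))
      fun k hk l hl => disjoint_pairAt (mem_bStarts.mp hk) (mem_bStarts.mp hl)
  have hCr : Realizes p e ((cEntries e).biUnion fun k => {k}) (∑ _k ∈ cEntries e, 1) :=
    Realizes.biUnion _ (fun k _ => realizes_singleton hp he k)
      fun k _ l _ h => disjoint_singleton.mpr h
  have hA : (({i | InA e i} : Finset (Fin n)).image e |>.biUnion
      fun v => ({i | e i = v} : Finset (Fin n))) = ({i | InA e i} : Finset (Fin n)) := by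
    ext i
    simp only [mem_biUnion, mem_image, mem_filter, mem_univ, true_and]
    constructor
    · rintro ⟨_, ⟨j, ⟨k, hk, hkj⟩, rfl⟩, hij⟩
      rcases eq_or_ne j i with rfl | hji
      · exact ⟨k, hk, hkj⟩
      · exact ⟨j, hji, hij.symm⟩
    · exact fun h => ⟨e i, ⟨i, h, rfl⟩, rfl⟩
  have hB : (bStarts e).biUnion pairAt = ({i | InB e i} : Finset (Fin n)) := by
    ext i
    simp only [mem_biUnion, mem_bStarts, mem_pairAt, mem_filter, mem_univ, true_and]
    constructor
    · rintro ⟨k, hk, rfl | h⟩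
      · exact Or.inl hk
      · exact Or.inr ⟨k, h.symm, hk⟩
    · rintro (h | ⟨k, hk, h⟩)
      · exact ⟨i, h, Or.inl rfl⟩
      · exact ⟨⟨k, by omega⟩, h, Or.inr hk.symm⟩
  rw [hA, sum_const_zero] at hAr
  rw [hB, sum_const, card_bStarts, smul_eq_mul, mul_one] at hBr
  rw [biUnion_singleton_eq_self, sum_const, card_cEntries, smul_eq_mul, mul_one] at hCr
  have hAB : Disjoint ({i | InA e i} : Finset (Fin n)) ({i | InB e i} : Finset (Fin n)) := by
    rw [disjoint_left]
    intro i hi hi'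
    exact (mem_filter.mp hi').2.not_inA (mem_filter.mp hi).2
  have hABC : Disjoint (({i | InA e i} : Finset (Fin n)) ∪ ({i | InB e i} : Finset (Fin n)))
      (cEntries e) := by
    rw [disjoint_left]
    intro i hi hi'
    have h := mem_cEntries.mp hi'
    rcases mem_union.mp hi with h' | h'
    · exact h.1 (mem_filter.mp h').2
    · exact h.2 (mem_filter.mp h').2
  have := (hAr.union hBr hAB).union hCr hABC
  rw [zero_add] at this
  convert this
  ext i
  simp only [mem_univ, mem_union, mem_filter, true_and, mem_cEntries, true_iff]
  tauto

lemma nonempty_factor_univ (p : ℕ) (e : Fin n → ℕ) :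
    Nonempty (Factor p e univ ≃+ StdGroup p e) := by
  let θ : StdGroup p e →+ Factor p e univ :=
    { toFun := fun x i => x i
      map_zero' := rfl
      map_add' := fun _ _ => rfl }
  refine ⟨(AddEquiv.ofBijective θ ⟨fun x y hxy => ?_, fun y => ?_⟩).symm⟩
  · ext i
    exact congrFun hxy ⟨i, mem_univ i⟩
  · exact ⟨fun i => y ⟨i, mem_univ i⟩, rfl⟩

end Blocks

end AbelianPGroup

open AbelianPGroup in
theorem mainTheorem2 (p : ℕ) (hp : p.Prime) {n : ℕ} (e : Fin n → ℕ)
    (P : Type*) [AddCommGroup P] (hP : AbelianPGroup.IsOfType p e P) :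
    AbelianPGroup.prodSpec p P =
      {N : ℕ | ∃ m : ℕ, AbelianPGroup.bCount e + AbelianPGroup.cCount e ≤ m ∧
        m ≤ ∑ i, e i ∧ N = p ^ m} := by
  obtain ⟨⟨he, hm⟩, ⟨g⟩⟩ := hP
  have : ∀ i, NeZero (p ^ e i) := fun i => ⟨(pow_pos hp.pos _).ne'⟩
  rw [prodSpec_congr p g]
  ext N
  constructor
  · rintro ⟨φ, rfl⟩
    obtain ⟨m, hmle, h⟩ := exists_prodFix_eq_pow hp (card_stdGroup p e) φ
    refine ⟨m, ?_, hmle, h⟩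
    have hle := pow_card_le_prodFix hp he (spaced_bStarts_union_cEntries hm) φ
    rw [Finset.card_union_of_disjoint (disjoint_bStarts_cEntries e), card_bStarts,
      card_cEntries, h] at hle
    exact (Nat.pow_le_pow_iff_right hp.one_lt).mp hle
  · rintro ⟨m, h1, h2, rfl⟩
    obtain ⟨f⟩ := nonempty_factor_univ p e
    rw [← prodSpec_congr p f]
    exact (realizes_univ hp he).2 m h1 h2
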